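/- Let $N,K$ be numbers of transmit antennas and of single-antenna receivers. For $i=1,\dots,K$ let $\bar h_i\in\mathbb C^{N}$, $\sigma_i^2>0$, $r_i>0$ and $\gamma_i>0$. For $w_1,\dots,w_K,h\in\mathbb C^N$ put $$\mathrm{SINR}_i(w,h)=\frac{|h^Hw_i|^2}{\sum_{k\ne i}|h^Hw_k|^2+\sigma_i^2}.$$ Consider three problems. (Robust) Minimize $\sum_i\|w_i\|^2$ over $w_1,\dots,w_K\in\mathbb C^N$ subject to $\mathrm{SINR}_i(w,\bar h_i+e)\ge\gamma_i$ for all $i$ and all $e\in\mathbb C^N$ with $\|e\|^2\le r_i^2$. (SDR) Minimize $\sum_i\mathrm{tr}(W_i)$ over Hermitian $N\times N$ matrices $W_i\succeq0$ and reals $\lambda_i\ge0$ ($i=1,\dots,K$) subject to, for all $i$, $$\begin{bmatrix}I\\ \bar h_i^H\end{bmatrix}\Big(\tfrac1{\gamma_i}W_i-\sum_{k\ne i}W_k\Big)\begin{bmatrix}I&\bar h_i\end{bmatrix}+\begin{bmatrix}\lambda_iI&0\\0&-\sigma_i^2-\lambda_ir_i^2\end{bmatrix}\succeq0 .$$ (Max-min)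 Maximize, over Hermitian $(N+1)\times(N+1)$ matrices $V_1,\dots,V_K\succeq0$ with $\mathrm{tr}(V_i)\le1+r_i^2$ and $[V_i]_{N+1,N+1}=1$, the optimal value of the inner problem: minimize $\sum_i\mathrm{tr}(W_i)$ over $W_1,\dots,W_K\succeq0$ subject to $\mathrm{tr}\big((\tfrac1{\gamma_i}W_i-\sum_{k\ne i}W_k)R_i\big)\ge\sigma_i^2$ for all $i$, where $R_i=[I\ \ \bar h_i]\,V_i\,[I\ \ \bar h_i]^H$. The value of the inner problem is $+\infty$ if it is infeasible. Assume that (Max-min) has an outer optimal solution $(V_1^\star,\dots,V_K^\star)$ at which the inner minimization has a unique optimal solution. Then (SDR) has an optimal solution with $\mathrm{rank}(W_i)=1$ for all $i$. Moreover, for every optimal solution $(W,\lambda)$ of (SDR), each $W_i$ has rank one and so can be written as $W_i=w_iw_i^H$ with $w_i\in\mathbb C^N$, and for every such choice $(w_1,\dots,w_K)$ is a globally optimal solution of (Robust). That is, SDR solves the worst-case robust beamforming problem to global optimality. -/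

import Mathlib

open scoped ComplexOrder

namespace RobustBeamforming

noncomputable section

/-- Data of a downlink with `N` transmit antennas and `K` single-antenna receivers:
channel estimates, noise powers `σ i ^ 2`, uncertainty radii and SINR requirements. -/
structure Downlink (N K : ℕ) where
  hbar : Fin K → EuclideanSpace ℂ (Fin N)
  σ : Fin K → ℝ
  r : Fin K → ℝ
  γ : Fin K → ℝ

variable {N K : ℕ}

/-- The SINR of receiver `i` for beamformers `w` and channel vector `h`;
`inner ℂ h v` is `hᴴ v`. -/
def SINR (D : Downlink N K) (w : Fin K → EuclideanSpace ℂ (Fin N)) (i : Fin K)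
    (h : EuclideanSpace ℂ (Fin N)) : ℝ :=
  ‖inner ℂ h (w i)‖ ^ 2 /
    (∑ k ∈ Finset.univ.erase i, ‖inner ℂ h (w k)‖ ^ 2 + D.σ i ^ 2)

/-! ### The worst-case robust beamforming problem -/

/-- `w` meets every SINR requirement for all channel errors in the uncertainty balls. -/
def RobustFeasible (D : Downlink N K) (w : Fin K → EuclideanSpace ℂ (Fin N)) : Prop :=
  ∀ i, ∀ e : EuclideanSpace ℂ (Fin N), ‖e‖ ^ 2 ≤ D.r i ^ 2 →
    D.γ i ≤ SINR D w i (D.hbar i + e)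

/-- `w` is a globally optimal solution of the worst-case robust problem. -/
def RobustOptimal (D : Downlink N K) (w : Fin K → EuclideanSpace ℂ (Fin N)) : Prop :=
  RobustFeasible D w ∧
    ∀ w', RobustFeasible D w' → ∑ i, ‖w i‖ ^ 2 ≤ ∑ i, ‖w' i‖ ^ 2

/-! ### The semidefinite relaxation -/

/-- The rank-one matrix `w wᴴ`. -/
def outer (w : EuclideanSpace ℂ (Fin N)) : Matrix (Fin N) (Fin N) ℂ :=
  Matrix.of fun a b => w a * star (w b)

/-- The transmit power `∑ i, tr (W i)`; the traces are real for Hermitian `W i`. -/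
def power (W : Fin K → Matrix (Fin N) (Fin N) ℂ) : ℝ :=
  ∑ i, (W i).trace.re

/-- The Hermitian matrix `(1 / γ i) W i - ∑ k ≠ i, W k`. -/
def signalMinusInterference (D : Downlink N K) (W : Fin K → Matrix (Fin N) (Fin N) ℂ)
    (i : Fin K) : Matrix (Fin N) (Fin N) ℂ :=
  (1 / D.γ i) • W i - ∑ k ∈ Finset.univ.erase i, W k

/-- The `N × (N + 1)` block matrix `[I  hbar i]`. -/
def idChannel (D : Downlink N K) (i : Fin K) : Matrix (Fin N) (Fin N ⊕ Unit) ℂ :=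
  Matrix.fromCols 1 (Matrix.replicateCol Unit (fun a => D.hbar i a))

/-- The linear matrix function `Ψ i (W, l)`. -/
def Psi (D : Downlink N K) (W : Fin K → Matrix (Fin N) (Fin N) ℂ) (l : ℝ) (i : Fin K) :
    Matrix (Fin N ⊕ Unit) (Fin N ⊕ Unit) ℂ :=
  (idChannel D i).conjTranspose * signalMinusInterference D W i * idChannel D i +
    Matrix.fromBlocks (l • (1 : Matrix (Fin N) (Fin N) ℂ)) 0 0
      ((-D.σ i ^ 2 - l * D.r i ^ 2) • (1 : Matrix Unit Unit ℂ))

/-- Feasibility for the SDR problem. -/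
def SDRFeasible (D : Downlink N K) (W : Fin K → Matrix (Fin N) (Fin N) ℂ)
    (l : Fin K → ℝ) : Prop :=
  (∀ i, (Psi D W (l i) i).PosSemidef) ∧ (∀ i, (W i).PosSemidef) ∧ ∀ i, 0 ≤ l i

/-- Optimality for the SDR problem. -/
def SDROptimal (D : Downlink N K) (W : Fin K → Matrix (Fin N) (Fin N) ℂ)
    (l : Fin K → ℝ) : Prop :=
  SDRFeasible D W l ∧ ∀ W' l', SDRFeasible D W' l' → power W ≤ power W'

/-! ### The max-min SDR problem -/

/-- Feasibility for the outer maximization. -/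
def OuterFeasible (D : Downlink N K)
    (V : Fin K → Matrix (Fin N ⊕ Unit) (Fin N ⊕ Unit) ℂ) : Prop :=
  ∀ i, (V i).trace.re ≤ 1 + D.r i ^ 2 ∧ V i (Sum.inr ()) (Sum.inr ()) = 1 ∧
    (V i).PosSemidef

/-- The matrix `R i = [I  hbar i] V i [I  hbar i]ᴴ`. -/
def corr (D : Downlink N K) (V : Fin K → Matrix (Fin N ⊕ Unit) (Fin N ⊕ Unit) ℂ)
    (i : Fin K) : Matrix (Fin N) (Fin N) ℂ :=
  idChannel D i * V i * (idChannel D i).conjTranspose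

/-- Feasibility for the inner minimization at `V`; the traces below are real. -/
def InnerFeasible (D : Downlink N K)
    (V : Fin K → Matrix (Fin N ⊕ Unit) (Fin N ⊕ Unit) ℂ)
    (W : Fin K → Matrix (Fin N) (Fin N) ℂ) : Prop :=
  (∀ i, D.σ i ^ 2 ≤ (signalMinusInterference D W i * corr D V i).trace.re) ∧
    ∀ i, (W i).PosSemidef

/-- Optimality for the inner minimization at `V`. -/
def InnerOptimal (D : Downlink N K)
    (V : Fin K → Matrix (Fin N ⊕ Unit) (Fin N ⊕ Unit) ℂ)
    (W : Fin K → Matrix (Fin N) (Fin N) ℂ) : Prop :=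
  InnerFeasible D V W ∧ ∀ W', InnerFeasible D V W' → power W ≤ power W'

/-- The optimal value of the inner minimization at `V`; it is `⊤` when that is infeasible. -/
def innerValue (D : Downlink N K)
    (V : Fin K → Matrix (Fin N ⊕ Unit) (Fin N ⊕ Unit) ℂ) : EReal :=
  ⨅ (W : Fin K → Matrix (Fin N) (Fin N) ℂ) (_ : InnerFeasible D V W), ((power W : ℝ) : EReal)

/-- `V` is an optimal solution of the outer maximization. -/
def OuterOptimal (D : Downlink N K)
    (V : Fin K → Matrix (Fin N ⊕ Unit) (Fin N ⊕ Unit) ℂ) : Prop :=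
  OuterFeasible D V ∧ ∀ V', OuterFeasible D V' → innerValue D V' ≤ innerValue D V

/-- The uniqueness condition: the max-min problem has an outer optimal solution at which the
inner minimization has exactly one optimal solution. -/
def UniqueInnerSolution (D : Downlink N K) : Prop :=
  ∃ V, OuterOptimal D V ∧ ∃! W, InnerOptimal D V W

end

end RobustBeamforming

/-!
The inner minimization at the given outer optimum `V` has exactly one solution `W₀`. Three facts
identify `W₀` with every solution of the semidefinite relaxation and show that it has rank one.

* Weak duality (`SDRFeasible.innerFeasible`): every point feasible for the relaxation is feasible
  for the inner problem at `V`, so it has power at least `power W₀`.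
* Strong duality (`exists_sdrFeasible_of_forall_innerValue_le`): since `V` is outer optimal, the
  inner value is at most `power W₀` at every outer feasible point. The constraints are linear in the
  cone generated by the outer feasible set, and the tuples of power at most `power W₀` form a
  compact convex set, so Komiya's form of the minimax lemma behind Sion's theorem yields one tuple
  of power at most `power W₀` that meets all quadratic constraints at once. The S-procedure
  (`Matrix.exists_forall_mul_quadForm_le`) turns these into the semidefinite constraints. Hence the
  relaxation attains the value `power W₀`, and by uniqueness only at `W₀`.
* Rank one (`exists_eq_outer_of_unique`): the inner problem has only `K` scalar constraints. Were
  some `W₀ j` not proportional to the rank-one matrix `v vᴴ` of a vector `v` in its range, the `K` scalings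
  of the `W₀ i` and this one extra direction would give `K + 1` parameters, hence a nonzero
  perturbation that preserves all constraints, and a second optimal solution.

Finally, the S-procedure shows that beamformers are robustly feasible exactly if their rank-one
matrices are feasible for the relaxation (`robustFeasible_iff`), so a rank-one solution of the
relaxation solves the robust problem.
-/

namespace Matrix

/-! ### Hermitian forms and the S-procedure -/

section QuadraticForms

variable {n : Type*} [Fintype n]

/-- The real quadratic form `x ↦ re (xᴴ A x)`. -/
def quadForm (A : Matrix n n ℂ) (x : n → ℂ) : ℝ :=
  (star x ⬝ᵥ A *ᵥ x).re

lemma quadForm_add_smul {A : Matrix n n ℂ} (hA : A.IsHermitian) (x y : n → ℂ) (d : ℂ) :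
    quadForm A (x + d • y) =
      quadForm A x + ‖d‖ ^ 2 * quadForm A y + 2 * (d * (star x ⬝ᵥ A *ᵥ y)).re := by
  have h : star y ⬝ᵥ A *ᵥ x = star (star x ⬝ᵥ A *ᵥ y) := by
    rw [star_dotProduct, star_mulVec, hA.eq, dotProduct_mulVec]
  have hd : star d * d = ((‖d‖ ^ 2 : ℝ) : ℂ) := by
    rw [Complex.star_def, Complex.conj_mul']; norm_cast
  have key : star (x + d • y) ⬝ᵥ A *ᵥ (x + d • y) = star x ⬝ᵥ A *ᵥ x +
      star d * d * (star y ⬝ᵥ A *ᵥ y) +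
      (d * (star x ⬝ᵥ A *ᵥ y) + star (d * (star x ⬝ᵥ A *ᵥ y))) := by
    simp only [star_add, star_smul, mulVec_add, mulVec_smul, dotProduct_add, add_dotProduct,
      smul_dotProduct, dotProduct_smul, smul_eq_mul, star_mul, h]
    ring
  unfold quadForm
  rw [key, hd, Complex.add_re, Complex.add_re, Complex.re_ofReal_mul, Complex.add_re,
    Complex.star_def, Complex.conj_re]
  ring

lemma posSemidef_iff_quadForm {A : Matrix n n ℂ} :
    A.PosSemidef ↔ A.IsHermitian ∧ ∀ x, 0 ≤ quadForm A x := by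
  refine ⟨fun h => ⟨h.1, fun x => h.re_dotProduct_nonneg x⟩, fun h => ?_⟩
  refine PosSemidef.of_dotProduct_mulVec_nonneg h.1 fun x => ?_
  rw [Complex.nonneg_iff]
  refine ⟨h.2 x, ?_⟩
  have : star (star x ⬝ᵥ A *ᵥ x) = star x ⬝ᵥ A *ᵥ x := by
    rw [← star_dotProduct, star_mulVec, h.1.eq, ← dotProduct_mulVec]
  exact (Complex.conj_eq_iff_im.1 this).symm

lemma quadForm_smul_right (A : Matrix n n ℂ) (x : n → ℂ) (c : ℂ) :
    quadForm A (c • x) = ‖c‖ ^ 2 * quadForm A x := by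
  have hd : star c * c = ((‖c‖ ^ 2 : ℝ) : ℂ) := by
    rw [Complex.star_def, Complex.conj_mul']; norm_cast
  unfold quadForm
  rw [star_smul, mulVec_smul, smul_dotProduct, dotProduct_smul, smul_smul, hd, smul_eq_mul,
    Complex.re_ofReal_mul]

lemma quadForm_add (A B : Matrix n n ℂ) (x : n → ℂ) :
    quadForm (A + B) x = quadForm A x + quadForm B x := by
  simp [quadForm, add_mulVec]

lemma quadForm_smul (c : ℝ) (A : Matrix n n ℂ) (x : n → ℂ) :
    quadForm (c • A) x = c * quadForm A x := by
  simp [quadForm, smul_mulVec]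

lemma quadForm_eq_trace (A : Matrix n n ℂ) (x : n → ℂ) :
    quadForm A x = (A * vecMulVec x (star x)).trace.re := by
  rw [mul_vecMulVec, trace_vecMulVec, dotProduct_comm, quadForm]

lemma quadForm_vecMulVec (v x : n → ℂ) :
    quadForm (vecMulVec v (star v)) x = ‖star x ⬝ᵥ v‖ ^ 2 := by
  have h : star v ⬝ᵥ x = star (star x ⬝ᵥ v) := star_dotProduct v x
  rw [quadForm, vecMulVec_mulVec, h]
  simp only [dotProduct_smul, MulOpposite.smul_eq_mul_unop, MulOpposite.unop_op]
  rw [Complex.star_def, Complex.mul_conj']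
  norm_cast

/-- A form of the **Cauchy–Schwarz inequality** for positive semidefinite matrices. -/
lemma PosSemidef.norm_dotProduct_mulVec_sq_le {A : Matrix n n ℂ} (hA : A.PosSemidef)
    (x y : n → ℂ) : ‖star x ⬝ᵥ A *ᵥ y‖ ^ 2 ≤ quadForm A x * quadForm A y := by
  obtain ⟨hH, hq⟩ := posSemidef_iff_quadForm.1 hA
  set b := star x ⬝ᵥ A *ᵥ y with hb
  have key : ∀ t : ℝ, 0 ≤ (‖b‖ ^ 2 * quadForm A y) * (t * t) + (-2 * ‖b‖ ^ 2) * t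
      + quadForm A x := by
    intro t
    have h := hq (x + (-(t : ℂ) * star b) • y)
    rw [quadForm_add_smul hH, ← hb, mul_assoc, Complex.star_def, Complex.conj_mul'] at h
    have h1 : (-(t : ℂ) * (‖b‖ : ℂ) ^ 2).re = -t * ‖b‖ ^ 2 := by
      rw [← Complex.ofReal_neg, Complex.re_ofReal_mul]; norm_cast
    rw [h1] at h
    simp only [norm_mul, norm_neg, Complex.norm_real, Real.norm_eq_abs, RCLike.norm_conj,
      mul_pow, sq_abs] at h
    linarith
  have hd := discrim_le_zero key
  rw [discrim] at hd
  rcases eq_or_ne (‖b‖ ^ 2) 0 with h0 | h0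
  · rw [h0]; exact mul_nonneg (hq x) (hq y)
  · have hpos : 0 < ‖b‖ ^ 2 := lt_of_le_of_ne (by positivity) h0.symm
    nlinarith

lemma exists_norm_eq_and_re_mul_eq_zero (b : ℂ) {τ : ℝ} (hτ : 0 ≤ τ) :
    ∃ d : ℂ, ‖d‖ = τ ∧ (d * b).re = 0 := by
  rcases eq_or_ne b 0 with rfl | hb
  · exact ⟨τ, by simp [abs_of_nonneg hτ], by simp⟩
  · refine ⟨(τ / ‖b‖ : ℝ) * (Complex.I * star b), ?_, ?_⟩
    · have : ‖b‖ ≠ 0 := norm_ne_zero_iff.2 hb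
      rw [norm_mul, norm_mul, Complex.norm_real, Complex.norm_I, norm_star, Real.norm_eq_abs,
        abs_of_nonneg (by positivity)]
      field_simp
    · rw [mul_assoc, mul_assoc, Complex.star_def, Complex.conj_mul', Complex.re_ofReal_mul]
      have : (Complex.I * (‖b‖ : ℂ) ^ 2).re = 0 := by
        rw [← Complex.ofReal_pow, Complex.re_mul_ofReal]; simp
      rw [this, mul_zero]

/-- The **S-procedure** for two Hermitian forms. A multiplier exists once
`A(y) / B(y) ≤ A(x) / B(x)` whenever `B(y) < 0 < B(x)`. Over `ℂ` this follows by evaluating `A` at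
the two null vectors `x ± d y` of `B`, with `d` of modulus `√(B(x) / -B(y))` and of a phase that
kills the cross term of `B`: adding the two values cancels the cross term of `A`. -/
theorem exists_forall_mul_quadForm_le {A B : Matrix n n ℂ} (hA : A.IsHermitian)
    (hB : B.IsHermitian) (h : ∀ x, 0 ≤ quadForm B x → 0 ≤ quadForm A x)
    {x₀ : n → ℂ} (hx₀ : 0 < quadForm B x₀) :
    ∃ l : ℝ, 0 ≤ l ∧ ∀ x, l * quadForm B x ≤ quadForm A x := by
  have cross : ∀ x y, 0 < quadForm B x → quadForm B y < 0 →
      quadForm A y / quadForm B y ≤ quadForm A x / quadForm B x := by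
    intro x y hx hy
    have hτ : 0 ≤ quadForm B x / -quadForm B y := div_nonneg hx.le (by linarith)
    obtain ⟨d, hd, hre⟩ := exists_norm_eq_and_re_mul_eq_zero (star x ⬝ᵥ B *ᵥ y)
      (Real.sqrt_nonneg (quadForm B x / -quadForm B y))
    have hd2 : ‖d‖ ^ 2 = quadForm B x / -quadForm B y := by rw [hd, Real.sq_sqrt hτ]
    have hcancel : quadForm B x + quadForm B x / -quadForm B y * quadForm B y = 0 := by
      have := hy.ne
      field_simp
      ring
    have h1 := h (x + d • y) (by rw [quadForm_add_smul hB, hre, hd2, hcancel]; simp)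
    have h2 := h (x + (-d) • y) (by
      rw [quadForm_add_smul hB, neg_mul, Complex.neg_re, hre, norm_neg, hd2, hcancel]; simp)
    rw [quadForm_add_smul hA, hd2] at h1
    rw [quadForm_add_smul hA, norm_neg, hd2, neg_mul, Complex.neg_re] at h2
    have h3 : 0 ≤ quadForm A x + quadForm B x / -quadForm B y * quadForm A y := by linarith
    rw [le_div_iff₀ hx]
    have e : quadForm A y / quadForm B y * quadForm B x =
        -(quadForm B x / -quadForm B y * quadForm A y) := by
      rw [div_neg]; ring
    linarith
  set S : Set ℝ := {t | ∃ x, 0 < quadForm B x ∧ t = quadForm A x / quadForm B x} with hS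
  have hne : S.Nonempty := ⟨_, x₀, hx₀, rfl⟩
  have h0 : ∀ t ∈ S, 0 ≤ t := by
    rintro _ ⟨x, hx, rfl⟩
    exact div_nonneg (h x hx.le) hx.le
  refine ⟨sInf S, le_csInf hne h0, fun x => ?_⟩
  rcases lt_trichotomy (quadForm B x) 0 with hx | hx | hx
  · rw [← div_le_iff_of_neg hx]
    apply le_csInf hne
    rintro _ ⟨y, hy, rfl⟩
    exact cross y x hy hx
  · rw [hx, mul_zero]
    exact h x hx.ge
  · rw [← le_div_iff₀ hx]
    exact csInf_le ⟨0, h0⟩ ⟨x, hx, rfl⟩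

open scoped MatrixOrder in
lemma PosSemidef.trace_mul_re_nonneg {A B : Matrix n n ℂ} (hA : A.PosSemidef)
    (hB : B.PosSemidef) : 0 ≤ (A * B).trace.re := by
  classical
  obtain ⟨C, rfl⟩ := CStarAlgebra.nonneg_iff_eq_star_mul_self.1 hB.nonneg
  rw [star_eq_conjTranspose, ← Matrix.mul_assoc, Matrix.trace_mul_comm, ← Matrix.mul_assoc]
  exact (Complex.nonneg_iff.1 (hA.mul_mul_conjTranspose_same C).trace_nonneg).1

lemma quadForm_conjTranspose_mul_mul {m : Type*} [Fintype m] (A : Matrix m m ℂ)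
    (C : Matrix m n ℂ) (x : n → ℂ) :
    quadForm (Cᴴ * A * C) x = quadForm A (C *ᵥ x) := by
  rw [quadForm, quadForm, ← mulVec_mulVec, ← mulVec_mulVec, dotProduct_mulVec, ← star_mulVec]

/-- A positive semidefinite matrix stays so under a small perturbation along itself and along a
direction that it dominates. -/
lemma posSemidef_add_smul_add_smul {A P : Matrix n n ℂ}
    (hA : A.PosSemidef) (hP : P.PosSemidef) {m : ℝ}
    (hPA : ∀ x, quadForm P x ≤ m * quadForm A x) {s t : ℝ} (hst : |s| + |t| * m ≤ 1) :
    (A + (s • A + t • P)).PosSemidef := by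
  refine posSemidef_iff_quadForm.2 ⟨?_, fun x => ?_⟩
  · have hs := hA.1
    have hp := hP.1
    unfold IsHermitian at *
    simp [hs, hp]
  · have h1 := (posSemidef_iff_quadForm.1 hA).2 x
    have h2 := (posSemidef_iff_quadForm.1 hP).2 x
    rw [quadForm_add, quadForm_add, quadForm_smul, quadForm_smul]
    have h3 : -|s| * quadForm A x ≤ s * quadForm A x :=
      mul_le_mul_of_nonneg_right (neg_abs_le s) h1
    have h4 : -|t| * quadForm P x ≤ t * quadForm P x :=
      mul_le_mul_of_nonneg_right (neg_abs_le t) h2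
    have h5 : |t| * quadForm P x ≤ |t| * (m * quadForm A x) :=
      mul_le_mul_of_nonneg_left (hPA x) (abs_nonneg t)
    have h6 : (|s| + |t| * m) * quadForm A x ≤ 1 * quadForm A x :=
      mul_le_mul_of_nonneg_right hst h1
    linarith

lemma continuous_quadForm (x : n → ℂ) :
    Continuous fun A : Matrix n n ℂ => quadForm A x := by
  unfold quadForm
  fun_prop

lemma isClosed_setOf_posSemidef :
    IsClosed {A : Matrix n n ℂ | A.PosSemidef} := by
  have : {A : Matrix n n ℂ | A.PosSemidef} =
      {A | Aᴴ = A} ∩ ⋂ x, {A : Matrix n n ℂ | 0 ≤ quadForm A x} := by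
    ext A
    simp only [Set.mem_ofPred_eq, Set.mem_inter_iff, Set.mem_iInter]
    exact posSemidef_iff_quadForm
  rw [this]
  exact (isClosed_eq (by fun_prop) continuous_id).inter
    (isClosed_iInter fun x => isClosed_le continuous_const (continuous_quadForm x))

lemma PosSemidef.trace_re_nonneg {A : Matrix n n ℂ} (hA : A.PosSemidef) :
    0 ≤ A.trace.re := (Complex.nonneg_iff.1 hA.trace_nonneg).1

lemma PosSemidef.norm_apply_le_trace {A : Matrix n n ℂ} (hA : A.PosSemidef)
    (a b : n) : ‖A a b‖ ≤ A.trace.re := by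
  classical
  have hq : ∀ a, quadForm A (Pi.single a 1) = (A a a).re := by
    intro a; simp [quadForm]
  have hd : ∀ a, 0 ≤ (A a a).re := fun a => (Complex.nonneg_iff.1 hA.diag_nonneg).1
  have hle : ∀ a, (A a a).re ≤ A.trace.re := by
    intro a
    rw [trace, Complex.re_sum]
    exact Finset.single_le_sum (f := fun a => (A a a).re) (fun a _ => hd a) (Finset.mem_univ a)
  have h := hA.norm_dotProduct_mulVec_sq_le (Pi.single a 1) (Pi.single b 1)
  rw [hq, hq] at h
  have h1 : star (Pi.single a (1 : ℂ)) ⬝ᵥ A *ᵥ Pi.single b 1 = A a b := by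
    simp
  rw [h1] at h
  refine abs_le_of_sq_le_sq' ?_ hA.trace_re_nonneg |>.2
  calc ‖A a b‖ ^ 2 ≤ (A a a).re * (A b b).re := h
    _ ≤ A.trace.re * A.trace.re :=
      mul_le_mul (hle a) (hle b) (hd b) hA.trace_re_nonneg
    _ = A.trace.re ^ 2 := (sq _).symm

end QuadraticForms

lemma star_sumElim {m n : Type*} (x : m → ℂ) (y : n → ℂ) :
    star (Sum.elim x y) = Sum.elim (star x) (star y) := by
  ext j; cases j <;> rfl

end Matrix

namespace RobustBeamforming

open Matrix

variable {N K : ℕ}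

/-! ### The semidefinite constraint as a quadratic constraint on the uncertainty ball -/

/-- The form `r i ^ 2 |t| ^ 2 - ‖e‖ ^ 2` in `(e, t)`, whose nonnegativity homogenizes membership
of `e / t` in the uncertainty ball. -/
noncomputable def ballForm (D : Downlink N K) (i : Fin K) :
    Matrix (Fin N ⊕ Unit) (Fin N ⊕ Unit) ℂ :=
  fromBlocks (-1) 0 0 ((D.r i ^ 2) • 1)

lemma ballForm_isHermitian (D : Downlink N K) (i : Fin K) : (ballForm D i).IsHermitian := by
  unfold ballForm
  rw [isHermitian_fromBlocks_iff]
  refine ⟨by simp [IsHermitian], by simp, by simp, by simp [IsHermitian]⟩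

lemma Psi_eq_sub_smul_ballForm (D : Downlink N K) (W : Fin K → Matrix (Fin N) (Fin N) ℂ) (l : ℝ)
    (i : Fin K) : Psi D W l i = Psi D W 0 i - l • ballForm D i := by
  unfold Psi ballForm
  rw [add_sub_assoc, sub_eq_add_neg (fromBlocks _ _ _ _), fromBlocks_smul, fromBlocks_neg,
    fromBlocks_add]
  congr 1
  simp only [smul_neg, smul_zero, neg_neg, neg_zero, zero_smul, zero_add, add_zero, sub_zero,
    zero_mul, smul_smul, ← sub_eq_add_neg, ← sub_smul]

lemma trace_ballForm_mul (D : Downlink N K) (i : Fin K)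
    (U : Matrix (Fin N ⊕ Unit) (Fin N ⊕ Unit) ℂ) :
    (ballForm D i * U).trace.re =
      (1 + D.r i ^ 2) * (U (Sum.inr ()) (Sum.inr ())).re - U.trace.re := by
  conv_lhs => rw [← fromBlocks_toBlocks U]
  rw [ballForm, fromBlocks_multiply]
  simp [trace, Fintype.sum_sum_type, toBlocks₁₁, toBlocks₂₂]
  simp only [← Complex.ofReal_pow, Complex.ofReal_re, Complex.ofReal_im]
  ring

lemma trace_Psi_zero_mul (D : Downlink N K) (W : Fin K → Matrix (Fin N) (Fin N) ℂ) (i : Fin K)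
    (U : Fin K → Matrix (Fin N ⊕ Unit) (Fin N ⊕ Unit) ℂ) :
    (Psi D W 0 i * U i).trace.re = (signalMinusInterference D W i * corr D U i).trace.re -
      D.σ i ^ 2 * (U i (Sum.inr ()) (Sum.inr ())).re := by
  have h1 : ((idChannel D i).conjTranspose * signalMinusInterference D W i * idChannel D i
      * U i).trace = (signalMinusInterference D W i * corr D U i).trace := by
    unfold corr
    rw [Matrix.mul_assoc, Matrix.mul_assoc, Matrix.trace_mul_comm]
    simp only [Matrix.mul_assoc]
  unfold Psi
  rw [Matrix.add_mul, trace_add, h1, Complex.add_re]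
  conv_lhs => rw [← fromBlocks_toBlocks (U i)]
  rw [fromBlocks_multiply]
  simp [trace, Fintype.sum_sum_type, toBlocks₂₂]
  simp only [← Complex.ofReal_pow, Complex.ofReal_re, Complex.ofReal_im]
  ring

lemma signalMinusInterference_isHermitian (D : Downlink N K)
    {W : Fin K → Matrix (Fin N) (Fin N) ℂ} (hW : ∀ i, (W i).IsHermitian) (i : Fin K) :
    (signalMinusInterference D W i).IsHermitian := by
  unfold signalMinusInterference IsHermitian
  rw [conjTranspose_sub, conjTranspose_smul, conjTranspose_sum, (hW i).eq]
  simp [fun k => (hW k).eq]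

lemma Psi_isHermitian (D : Downlink N K) {W : Fin K → Matrix (Fin N) (Fin N) ℂ}
    (hW : ∀ i, (W i).IsHermitian) (l : ℝ) (i : Fin K) : (Psi D W l i).IsHermitian := by
  unfold Psi
  refine IsHermitian.add
    (isHermitian_conjTranspose_mul_mul _ (signalMinusInterference_isHermitian D hW i)) ?_
  rw [isHermitian_fromBlocks_iff]
  refine ⟨by simp [IsHermitian], by simp, by simp, by simp [IsHermitian]⟩

lemma quadForm_ballForm (D : Downlink N K) (i : Fin K) (e : EuclideanSpace ℂ (Fin N)) (t : ℂ) :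
    quadForm (ballForm D i) (Sum.elim e (fun _ => t)) = D.r i ^ 2 * ‖t‖ ^ 2 - ‖e‖ ^ 2 := by
  unfold quadForm ballForm
  rw [fromBlocks_mulVec]
  have he : star (e : Fin N → ℂ) ⬝ᵥ (e : Fin N → ℂ) = ((‖e‖ ^ 2 : ℝ) : ℂ) := by
    rw [dotProduct_comm, ← EuclideanSpace.inner_eq_star_dotProduct, inner_self_eq_norm_sq_to_K]
    norm_cast
  rw [star_sumElim, sumElim_dotProduct_sumElim, Sum.elim_comp_inl, Sum.elim_comp_inr]
  rw [zero_mulVec, zero_mulVec, add_zero, zero_add, neg_mulVec, one_mulVec, dotProduct_neg, he,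
    smul_mulVec, one_mulVec, dotProduct_smul]
  have h : (star fun _ : Unit => t) ⬝ᵥ (fun _ : Unit => t) = ((‖t‖ ^ 2 : ℝ) : ℂ) := by
    simp [dotProduct, Complex.conj_mul']
  rw [h, Complex.add_re, Complex.neg_re, Complex.smul_re, Complex.ofReal_re, Complex.ofReal_re,
    smul_eq_mul]
  ring

lemma quadForm_Psi_zero (D : Downlink N K) (W : Fin K → Matrix (Fin N) (Fin N) ℂ) (i : Fin K)
    (e : EuclideanSpace ℂ (Fin N)) (t : ℂ) :
    quadForm (Psi D W 0 i) (Sum.elim e (fun _ => t)) =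
      quadForm (signalMinusInterference D W i) ((e + t • D.hbar i : EuclideanSpace ℂ (Fin N))) -
        D.σ i ^ 2 * ‖t‖ ^ 2 := by
  have h1 : idChannel D i *ᵥ Sum.elim (e : Fin N → ℂ) (fun _ => t) =
      (e + t • D.hbar i : EuclideanSpace ℂ (Fin N)) := by
    rw [idChannel, fromCols_mulVec_sumElim, one_mulVec]
    ext a
    simp [mulVec, dotProduct, mul_comm]
  unfold Psi
  rw [quadForm_add, quadForm_conjTranspose_mul_mul, h1]
  unfold quadForm
  rw [fromBlocks_mulVec, star_sumElim, sumElim_dotProduct_sumElim, Sum.elim_comp_inl,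
    Sum.elim_comp_inr]
  have h : (star fun _ : Unit => t) ⬝ᵥ (fun _ : Unit => t) = ((‖t‖ ^ 2 : ℝ) : ℂ) := by
    simp [dotProduct, Complex.conj_mul']
  rw [zero_mulVec, zero_mulVec, add_zero, zero_add, zero_smul, zero_mulVec, dotProduct_zero,
    smul_mulVec, one_mulVec, dotProduct_smul, h, zero_add, Complex.smul_re, Complex.ofReal_re,
    smul_eq_mul]
  ring

/-- **S-procedure** for the uncertainty ball: the semidefinite constraint of receiver `i` can be met
by some multiplier exactly if the quadratic constraint holds for all channel errors. -/
lemma exists_Psi_posSemidef_iff (D : Downlink N K) {W : Fin K → Matrix (Fin N) (Fin N) ℂ}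
    (hW : ∀ i, (W i).IsHermitian) (i : Fin K) (hr : 0 < D.r i) :
    (∃ l : ℝ, 0 ≤ l ∧ (Psi D W l i).PosSemidef) ↔
      ∀ x, 0 ≤ quadForm (ballForm D i) x → 0 ≤ quadForm (Psi D W 0 i) x := by
  have hq : ∀ l x, quadForm (Psi D W l i) x =
      quadForm (Psi D W 0 i) x - l * quadForm (ballForm D i) x := by
    intro l x
    rw [Psi_eq_sub_smul_ballForm, sub_eq_add_neg, ← neg_smul, quadForm_add, quadForm_smul]
    ring
  constructor
  · rintro ⟨l, hl, h⟩ x hx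
    have h1 := (posSemidef_iff_quadForm.1 h).2 x
    rw [hq] at h1
    nlinarith
  · intro h
    obtain ⟨l, hl, h⟩ := exists_forall_mul_quadForm_le (Psi_isHermitian D hW 0 i)
      (ballForm_isHermitian D i) h (x₀ := Sum.elim (0 : EuclideanSpace ℂ (Fin N)) (fun _ => 1))
      (by rw [quadForm_ballForm]; simpa using pow_pos hr 2)
    refine ⟨l, hl, posSemidef_iff_quadForm.2 ⟨Psi_isHermitian D hW l i, fun x => ?_⟩⟩
    rw [hq]
    linarith [h x]

/-- Homogenization: only the vectors with last coordinate one matter, and these are the channel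
errors. -/
lemma quadForm_Psi_zero_nonneg_iff (D : Downlink N K) (W : Fin K → Matrix (Fin N) (Fin N) ℂ)
    (i : Fin K) :
    (∀ x, 0 ≤ quadForm (ballForm D i) x → 0 ≤ quadForm (Psi D W 0 i) x) ↔
      ∀ e : EuclideanSpace ℂ (Fin N), ‖e‖ ^ 2 ≤ D.r i ^ 2 →
        D.σ i ^ 2 ≤ quadForm (signalMinusInterference D W i)
          (D.hbar i + e : EuclideanSpace ℂ (Fin N)) := by
  constructor
  · intro h e he
    have h1 := h (Sum.elim e (fun _ => 1)) (by rw [quadForm_ballForm]; simpa using he)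
    rw [quadForm_Psi_zero] at h1
    simpa [add_comm e] using h1
  · intro h x hx
    obtain ⟨e, t, rfl⟩ : ∃ (e : EuclideanSpace ℂ (Fin N)) (t : ℂ),
        x = Sum.elim e (fun _ => t) :=
      ⟨WithLp.toLp 2 (x ∘ Sum.inl), x (Sum.inr ()), by ext j; rcases j with j | j <;> rfl⟩
    rw [quadForm_ballForm] at hx
    rcases eq_or_ne t 0 with rfl | ht
    · -- the direction at infinity: the ball constraint forces the vector to vanish
      have he : e = 0 := by
        have : ‖e‖ ^ 2 ≤ 0 := by simpa using hx
        simpa using le_antisymm this (by positivity)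
      subst he
      rw [quadForm_Psi_zero]
      simp [quadForm]
    · have ht2 : 0 < ‖t‖ ^ 2 := by positivity
      have h1 := h (t⁻¹ • e) (by
        rw [norm_smul, mul_pow, norm_inv, inv_pow, inv_mul_le_iff₀ ht2]
        linarith)
      have h2 : e + t • D.hbar i = t • (D.hbar i + t⁻¹ • e) := by
        rw [smul_add, smul_inv_smul₀ ht, add_comm]
      rw [quadForm_Psi_zero, h2, WithLp.ofLp_smul, quadForm_smul_right]
      nlinarith

/-! ### Rank-one tuples and the robust problem -/

lemma outer_eq_vecMulVec (w : EuclideanSpace ℂ (Fin N)) :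
    outer w = vecMulVec (w : Fin N → ℂ) (star (w : Fin N → ℂ)) := rfl

lemma outer_posSemidef (w : EuclideanSpace ℂ (Fin N)) : (outer w).PosSemidef :=
  posSemidef_vecMulVec_self_star _

lemma trace_outer (w : EuclideanSpace ℂ (Fin N)) : (outer w).trace.re = ‖w‖ ^ 2 := by
  rw [outer_eq_vecMulVec, trace_vecMulVec, EuclideanSpace.norm_sq_eq]
  simp [dotProduct, Complex.mul_conj']
  norm_cast

lemma quadForm_outer (w h : EuclideanSpace ℂ (Fin N)) :
    quadForm (outer w) h = ‖inner ℂ h w‖ ^ 2 := by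
  rw [outer_eq_vecMulVec, quadForm_vecMulVec, EuclideanSpace.inner_eq_star_dotProduct,
    dotProduct_comm]

lemma quadForm_signalMinusInterference (D : Downlink N K)
    (W : Fin K → Matrix (Fin N) (Fin N) ℂ) (i : Fin K) (x : Fin N → ℂ) :
    quadForm (signalMinusInterference D W i) x =
      1 / D.γ i * quadForm (W i) x - ∑ k ∈ Finset.univ.erase i, quadForm (W k) x := by
  simp [quadForm, signalMinusInterference, sub_mulVec, smul_mulVec, sum_mulVec, dotProduct_sum]

lemma le_SINR_iff (D : Downlink N K) (hσ : ∀ i, 0 < D.σ i ^ 2) (hγ : ∀ i, 0 < D.γ i)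
    (w : Fin K → EuclideanSpace ℂ (Fin N)) (i : Fin K) (h : EuclideanSpace ℂ (Fin N)) :
    D.γ i ≤ SINR D w i h ↔
      D.σ i ^ 2 ≤ quadForm (signalMinusInterference D (fun k => outer (w k)) i) h := by
  have hpos : 0 < ∑ k ∈ Finset.univ.erase i, ‖inner ℂ h (w k)‖ ^ 2 + D.σ i ^ 2 :=
    add_pos_of_nonneg_of_pos (Finset.sum_nonneg fun _ _ => by positivity) (hσ i)
  rw [SINR, le_div_iff₀ hpos, quadForm_signalMinusInterference]
  simp only [quadForm_outer]
  rw [le_sub_iff_add_le, one_div, le_inv_mul_iff₀ (hγ i), add_comm (D.σ i ^ 2)]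

/-- By the S-procedure, beamformers are robustly feasible exactly if their rank-one matrices are
feasible for the semidefinite relaxation. -/
lemma robustFeasible_iff (D : Downlink N K) (hσ : ∀ i, 0 < D.σ i ^ 2) (hr : ∀ i, 0 < D.r i)
    (hγ : ∀ i, 0 < D.γ i) (w : Fin K → EuclideanSpace ℂ (Fin N)) :
    RobustFeasible D w ↔ ∃ l, SDRFeasible D (fun k => outer (w k)) l := by
  have hH : ∀ k, (outer (w k)).IsHermitian := fun k => (outer_posSemidef _).1
  have h : RobustFeasible D w ↔
      ∀ i, ∃ l : ℝ, 0 ≤ l ∧ (Psi D (fun k => outer (w k)) l i).PosSemidef := by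
    refine forall_congr' fun i => ?_
    rw [exists_Psi_posSemidef_iff D hH i (hr i), quadForm_Psi_zero_nonneg_iff]
    simp only [le_SINR_iff D hσ hγ]
  rw [h, Classical.skolem]
  exact exists_congr fun l => ⟨fun h => ⟨fun i => (h i).2, fun i => outer_posSemidef _,
    fun i => (h i).1⟩, fun h i => ⟨h.2.2 i, h.1 i⟩⟩

lemma power_outer (w : Fin K → EuclideanSpace ℂ (Fin N)) :
    power (fun k => outer (w k)) = ∑ i, ‖w i‖ ^ 2 := by
  simp only [power, trace_outer]

/-! ### Unique inner solutions have rank one -/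

/-- The received signal-minus-interference powers `tr (Φ i (W) R i)`, as a real-linear map of the
tuple `W`. -/
noncomputable def receivedPower (D : Downlink N K)
    (V : Fin K → Matrix (Fin N ⊕ Unit) (Fin N ⊕ Unit) ℂ) :
    (Fin K → Matrix (Fin N) (Fin N) ℂ) →ₗ[ℝ] (Fin K → ℝ) where
  toFun W i := (signalMinusInterference D W i * corr D V i).trace.re
  map_add' W W' := by
    ext i
    have : signalMinusInterference D (W + W') i =
        signalMinusInterference D W i + signalMinusInterference D W' i := by
      simp only [signalMinusInterference, Pi.add_apply, smul_add, Finset.sum_add_distrib]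
      abel
    simp only [this, Matrix.add_mul, trace_add, Complex.add_re, Pi.add_apply]
  map_smul' c W := by
    ext i
    have : signalMinusInterference D (c • W) i = c • signalMinusInterference D W i := by
      simp only [signalMinusInterference, Pi.smul_apply, smul_sub, Finset.smul_sum,
        smul_comm c]
    simp only [this, Matrix.smul_mul, trace_smul, Complex.smul_re, Pi.smul_apply, RingHom.id_apply]

/-- The transmit power as a real-linear map. -/
noncomputable def powerₗ : (Fin K → Matrix (Fin N) (Fin N) ℂ) →ₗ[ℝ] ℝ where
  toFun := power
  map_add' W W' := by simp [power, Finset.sum_add_distrib]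
  map_smul' c W := by simp [power, Finset.mul_sum]

lemma powerₗ_apply (W : Fin K → Matrix (Fin N) (Fin N) ℂ) : powerₗ W = power W := rfl

lemma innerFeasible_iff_receivedPower (D : Downlink N K)
    (V : Fin K → Matrix (Fin N ⊕ Unit) (Fin N ⊕ Unit) ℂ)
    (W : Fin K → Matrix (Fin N) (Fin N) ℂ) :
    InnerFeasible D V W ↔ (∀ i, D.σ i ^ 2 ≤ receivedPower D V W i) ∧ ∀ i, (W i).PosSemidef :=
  Iff.rfl

/-- The matrix of receiver `j` cannot vanish: the others only interfere, so the left side of its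
constraint would be nonpositive. -/
lemma ne_zero_of_innerFeasible {D : Downlink N K} (hσ : ∀ i, 0 < D.σ i ^ 2)
    {V : Fin K → Matrix (Fin N ⊕ Unit) (Fin N ⊕ Unit) ℂ} (hV : ∀ i, (V i).PosSemidef)
    {W : Fin K → Matrix (Fin N) (Fin N) ℂ} (hW : InnerFeasible D V W) (j : Fin K) :
    W j ≠ 0 := by
  intro h0
  have h1 := hW.1 j
  have h2 : (signalMinusInterference D W j * corr D V j).trace.re =
      - ∑ k ∈ Finset.univ.erase j, (W k * corr D V j).trace.re := by
    simp [signalMinusInterference, h0, Matrix.sum_mul, trace_sum]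
  have h3 : 0 ≤ ∑ k ∈ Finset.univ.erase j, (W k * corr D V j).trace.re :=
    Finset.sum_nonneg fun k _ =>
      (hW.2 k).trace_mul_re_nonneg ((hV j).mul_mul_conjTranspose_same _)
  linarith [hσ j]

/-- If the inner solution is unique, perturbing along the `K` scalings and one further direction
dominated by `W j` cannot stay inside the `K` trace equations unless that direction is
proportional to `W j`. -/
lemma exists_smul_eq_of_unique {D : Downlink N K} (hσ : ∀ i, 0 < D.σ i ^ 2)
    {V : Fin K → Matrix (Fin N ⊕ Unit) (Fin N ⊕ Unit) ℂ} (hV : ∀ i, (V i).PosSemidef)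
    {W : Fin K → Matrix (Fin N) (Fin N) ℂ} (hW : InnerOptimal D V W)
    (huniq : ∀ W', InnerOptimal D V W' → W' = W) (j : Fin K)
    {P : Matrix (Fin N) (Fin N) ℂ} (hP : P.PosSemidef) (hP0 : P ≠ 0) {m : ℝ} (hm : 0 ≤ m)
    (hPW : ∀ x, quadForm P x ≤ m * quadForm (W j) x) :
    ∃ c : ℝ, W j = c • P := by
  have hW0 := ne_zero_of_innerFeasible hσ hV hW.1
  let L : ((Fin K → ℝ) × ℝ) →ₗ[ℝ] (Fin K → Matrix (Fin N) (Fin N) ℂ) :=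
    { toFun := fun p i => p.1 i • W i + (if i = j then p.2 else 0) • P
      map_add' := by
        intro p q
        ext1 i
        by_cases h : i = j
        · simp [h, add_smul]
          abel
        · simp [h, add_smul]
      map_smul' := by
        intro c p
        ext1 i
        by_cases h : i = j <;> simp [h, mul_smul] }
  have hL : ∀ p i, L p i = p.1 i • W i + (if i = j then p.2 else 0) • P := fun _ _ => rfl
  -- `K + 1` parameters against `K` equations
  have hker : LinearMap.ker (receivedPower D V ∘ₗ L) ≠ ⊥ :=
    LinearMap.ker_ne_bot_of_finrank_lt (by simp)
  obtain ⟨p, hp, hp0⟩ := Submodule.exists_mem_ne_zero_of_ne_bot hker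
  replace hp : receivedPower D V (L p) = 0 := hp
  -- the step size keeps every perturbed matrix positive semidefinite
  set M : ℝ := 1 + (∑ i, |p.1 i| + |p.2| * m) with hM
  have hMpos : 0 < M := by
    have : 0 ≤ ∑ i, |p.1 i| := Finset.sum_nonneg fun _ _ => abs_nonneg _
    have : 0 ≤ |p.2| * m := by positivity
    linarith
  have hfeas : ∀ t : ℝ, |t| ≤ M⁻¹ → InnerFeasible D V (W + t • L p) := by
    intro t ht
    rw [innerFeasible_iff_receivedPower]
    refine ⟨fun i => ?_, fun i => ?_⟩
    · rw [map_add, map_smul, hp, smul_zero, add_zero]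
      exact hW.1.1 i
    · have hle : ∀ b : ℝ, |b| ≤ |p.2| → |t * p.1 i| + |t * b| * m ≤ 1 := by
        intro b hb
        have h1 : |p.1 i| ≤ ∑ i, |p.1 i| :=
          Finset.single_le_sum (f := fun i => |p.1 i|) (fun _ _ => abs_nonneg _)
            (Finset.mem_univ i)
        have h2 : |b| * m ≤ |p.2| * m := mul_le_mul_of_nonneg_right hb hm
        have h3 : |p.1 i| + |b| * m ≤ M := by linarith
        have h4 : 0 ≤ |p.1 i| + |b| * m := by positivity
        calc |t * p.1 i| + |t * b| * m = |t| * (|p.1 i| + |b| * m) := by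
              rw [abs_mul, abs_mul]; ring
          _ ≤ M⁻¹ * M := mul_le_mul ht h3 h4 (inv_nonneg.2 hMpos.le)
          _ = 1 := inv_mul_cancel₀ hMpos.ne'
      rw [Pi.add_apply, Pi.smul_apply, hL, smul_add, smul_smul, smul_smul]
      by_cases hij : i = j
      · subst hij
        simp only [if_true]
        exact posSemidef_add_smul_add_smul (hW.1.2 i) hP hPW (hle _ le_rfl)
      · simp only [hij, if_false, mul_zero]
        rw [zero_smul, ← zero_smul ℝ (0 : Matrix (Fin N) (Fin N) ℂ)]
        refine posSemidef_add_smul_add_smul (m := 0) (hW.1.2 i) PosSemidef.zero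
          (fun x => by simp [quadForm]) ?_
        simpa using (hle 0 (by simp))
  have hpow : ∀ t : ℝ, power (W + t • L p) = power W + t * power (L p) := by
    intro t
    rw [← powerₗ_apply, map_add, map_smul, powerₗ_apply, powerₗ_apply, smul_eq_mul]
  have hMi : 0 < M⁻¹ := inv_pos.2 hMpos
  -- both signs of the step are feasible, so optimality makes the power stationary along `L p`
  have hzero : power (L p) = 0 := by
    have h1 := hW.2 _ (hfeas M⁻¹ (by rw [abs_of_pos hMi]))
    have h2 := hW.2 _ (hfeas (-M⁻¹) (by rw [abs_neg, abs_of_pos hMi]))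
    rw [hpow] at h1 h2
    have h3 : M⁻¹ * power (L p) = 0 := by linarith
    exact (mul_eq_zero.1 h3).resolve_left hMi.ne'
  have hopt : InnerOptimal D V (W + M⁻¹ • L p) :=
    ⟨hfeas _ (by rw [abs_of_pos hMi]), fun W' h' => by
      rw [hpow, hzero, mul_zero, add_zero]; exact hW.2 W' h'⟩
  have hLp : L p = 0 := by
    have h1 := huniq _ hopt
    rw [add_eq_left] at h1
    exact (smul_eq_zero.1 h1).resolve_left hMi.ne'
  have hother : ∀ i, i ≠ j → p.1 i = 0 := by
    intro i hij
    have h1 := congrFun hLp i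
    rw [hL] at h1
    simp only [hij, if_false, zero_smul, add_zero, Pi.zero_apply] at h1
    exact (smul_eq_zero.1 h1).resolve_right (hW0 i)
  have hj : p.1 j • W j + p.2 • P = 0 := by
    have h1 := congrFun hLp j
    rw [hL] at h1
    simpa using h1
  have ha : p.1 j ≠ 0 := by
    intro ha
    rw [ha, zero_smul, zero_add] at hj
    have hb := (smul_eq_zero.1 hj).resolve_right hP0
    apply hp0
    refine Prod.ext (funext fun i => ?_) hb
    by_cases hij : i = j
    · rw [hij, ha]; rfl
    · exact hother i hij
  refine ⟨-(p.1 j)⁻¹ * p.2, ?_⟩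
  have h1 : p.1 j • W j = -(p.2 • P) := eq_neg_of_add_eq_zero_left hj
  rw [mul_smul, neg_smul, ← smul_neg, ← h1, inv_smul_smul₀ ha]

/-- A unique inner solution has rank one: the direction used is the rank-one matrix built from a
nonzero vector `W j y`, which `W j` dominates by the Cauchy–Schwarz inequality. -/
lemma exists_eq_outer_of_unique {D : Downlink N K} (hσ : ∀ i, 0 < D.σ i ^ 2)
    {V : Fin K → Matrix (Fin N ⊕ Unit) (Fin N ⊕ Unit) ℂ} (hV : ∀ i, (V i).PosSemidef)
    {W : Fin K → Matrix (Fin N) (Fin N) ℂ} (hW : InnerOptimal D V W)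
    (huniq : ∀ W', InnerOptimal D V W' → W' = W) (j : Fin K) :
    ∃ w : EuclideanSpace ℂ (Fin N), w ≠ 0 ∧ W j = outer w := by
  have hW0 := ne_zero_of_innerFeasible hσ hV hW.1 j
  have hpsd := hW.1.2 j
  obtain ⟨y, hy⟩ : ∃ y, W j *ᵥ y ≠ 0 := by
    by_contra! h
    exact hW0 (Matrix.mulVec_injective (funext fun y => by rw [h y, zero_mulVec]))
  set v := W j *ᵥ y with hv
  have hP0 : vecMulVec v (star v) ≠ 0 := by
    intro h
    rw [vecMulVec_eq_zero] at h
    simp [hy] at h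
  obtain ⟨c, hc⟩ := exists_smul_eq_of_unique hσ hV hW huniq j
    (posSemidef_vecMulVec_self_star v) hP0 ((posSemidef_iff_quadForm.1 hpsd).2 y) (fun x => by
      rw [quadForm_vecMulVec, mul_comm]
      exact hpsd.norm_dotProduct_mulVec_sq_le x y)
  have hc0 : 0 < c := by
    by_contra! hle
    have h1 := (posSemidef_iff_quadForm.1 hpsd).2 v
    rw [hc, quadForm_smul, quadForm_vecMulVec] at h1
    have h2 : star v ⬝ᵥ v ≠ 0 := fun h => hy (dotProduct_star_self_eq_zero.1 h)
    have h3 : 0 < ‖star v ⬝ᵥ v‖ ^ 2 := by positivity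
    have h4 : c = 0 := le_antisymm hle (by
      by_contra! hneg
      nlinarith)
    exact hW0 (by rw [hc, h4, zero_smul])
  refine ⟨WithLp.toLp 2 ((Real.sqrt c : ℂ) • v), ?_, ?_⟩
  · intro h
    have h1 : (Real.sqrt c : ℂ) • v = 0 := congrArg WithLp.ofLp h
    rw [smul_eq_zero] at h1
    refine h1.elim (fun h => ?_) hy
    have := Real.sqrt_pos.2 hc0
    exact this.ne' (by exact_mod_cast h)
  · rw [hc]
    ext a b
    have hs : (Real.sqrt c : ℂ) * (Real.sqrt c : ℂ) = (c : ℂ) := by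
      rw [← Complex.ofReal_mul, Real.mul_self_sqrt hc0.le]
    simp only [outer, vecMulVec, of_apply, Matrix.smul_apply, Pi.smul_apply, smul_eq_mul,
      Pi.star_apply, star_mul, Complex.real_smul, Complex.star_def, Complex.conj_ofReal, ← hs]
    ring

lemma rank_outer {w : EuclideanSpace ℂ (Fin N)} (hw : w ≠ 0) : (outer w).rank = 1 := by
  apply le_antisymm (rank_vecMulVec_le _ _)
  rw [Nat.one_le_iff_ne_zero, Ne, rank, Submodule.finrank_eq_zero, LinearMap.range_eq_bot]
  intro h
  have h1 : quadForm (outer w) w = 0 := by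
    have h2 : outer w *ᵥ (w : Fin N → ℂ) = 0 := LinearMap.congr_fun h (w : Fin N → ℂ)
    rw [quadForm, h2, dotProduct_zero, Complex.zero_re]
  rw [quadForm_outer] at h1
  simp [hw] at h1

/-! ### Compactness and attainment of the inner minimum -/

lemma continuous_receivedPower (D : Downlink N K)
    (V : Fin K → Matrix (Fin N ⊕ Unit) (Fin N ⊕ Unit) ℂ) : Continuous (receivedPower D V) :=
  LinearMap.continuous_of_finiteDimensional _

lemma continuous_power : Continuous (power : (Fin K → Matrix (Fin N) (Fin N) ℂ) → ℝ) :=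
  LinearMap.continuous_of_finiteDimensional powerₗ

/-- The tuples of positive semidefinite matrices of transmit power at most `c`. -/
def boundedPower (N K : ℕ) (c : ℝ) : Set (Fin K → Matrix (Fin N) (Fin N) ℂ) :=
  {W | (∀ i, (W i).PosSemidef) ∧ power W ≤ c}

lemma isClosed_boundedPower (c : ℝ) : IsClosed (boundedPower N K c) := by
  have : boundedPower N K c =
      (⋂ i, {W | (W i).PosSemidef}) ∩ {W | power W ≤ c} := by
    ext W
    simp [boundedPower]
  rw [this]
  exact (isClosed_iInter fun i => isClosed_setOf_posSemidef.preimage (continuous_apply i)).inter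
    (isClosed_le continuous_power continuous_const)

lemma isCompact_boundedPower (c : ℝ) : IsCompact (boundedPower N K c) := by
  have hbox : IsCompact (Set.univ.pi fun _ : Fin K => Set.univ.pi fun _ : Fin N =>
      Set.univ.pi fun _ : Fin N => Metric.closedBall (0 : ℂ) c) :=
    isCompact_univ_pi fun _ => isCompact_univ_pi fun _ => isCompact_univ_pi fun _ =>
      isCompact_closedBall _ _
  refine IsCompact.of_isClosed_subset hbox (isClosed_boundedPower c) ?_
  intro W hW i _ a _ b _
  rw [mem_closedBall_zero_iff]
  refine ((hW.1 i).norm_apply_le_trace a b).trans (le_trans ?_ hW.2)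
  exact Finset.single_le_sum (f := fun i => (W i).trace.re)
    (fun i _ => (hW.1 i).trace_re_nonneg) (Finset.mem_univ i)

lemma convex_boundedPower (c : ℝ) : Convex ℝ (boundedPower N K c) := by
  intro W hW W' hW' a b ha hb hab
  refine ⟨fun i => ((hW.1 i).smul ha).add ((hW'.1 i).smul hb), ?_⟩
  rw [← powerₗ_apply, map_add, map_smul, map_smul, powerₗ_apply, powerₗ_apply, smul_eq_mul,
    smul_eq_mul]
  calc a * power W + b * power W' ≤ a * c + b * c :=
        add_le_add (mul_le_mul_of_nonneg_left hW.2 ha) (mul_le_mul_of_nonneg_left hW'.2 hb)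
    _ = c := by rw [← add_mul, hab, one_mul]

lemma exists_innerFeasible_of_innerValue_le {D : Downlink N K}
    {V : Fin K → Matrix (Fin N ⊕ Unit) (Fin N ⊕ Unit) ℂ} {g : ℝ}
    (h : innerValue D V ≤ (g : EReal)) : ∃ W, InnerFeasible D V W ∧ power W ≤ g := by
  have hex : ∀ c : ℝ, g < c → ∃ W, InnerFeasible D V W ∧ power W < c := by
    intro c hc
    have h1 : innerValue D V < (c : EReal) := h.trans_lt (by exact_mod_cast hc)
    simp only [innerValue, iInf_lt_iff] at h1
    obtain ⟨W, hW, hlt⟩ := h1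
    exact ⟨W, hW, by exact_mod_cast hlt⟩
  -- the inner minimum is attained, by compactness of its sublevel sets
  have hcomp : IsCompact (boundedPower N K (g + 1) ∩
      ⋂ i, {W | D.σ i ^ 2 ≤ receivedPower D V W i}) :=
    (isCompact_boundedPower _).inter_right (isClosed_iInter fun i => isClosed_le continuous_const
      ((continuous_apply i).comp (continuous_receivedPower D V)))
  have hmem : ∀ W, InnerFeasible D V W → power W ≤ g + 1 → W ∈ boundedPower N K (g + 1) ∩
      ⋂ i, {W | D.σ i ^ 2 ≤ receivedPower D V W i} := fun W hW hp =>
    ⟨⟨hW.2, hp⟩, Set.mem_iInter.2 hW.1⟩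
  obtain ⟨W₁, hW₁, hp₁⟩ := hex (g + 1) (by linarith)
  obtain ⟨W, hW, hmin⟩ := hcomp.exists_isMinOn ⟨W₁, hmem W₁ hW₁ hp₁.le⟩
    continuous_power.continuousOn
  refine ⟨W, ⟨Set.mem_iInter.1 hW.2, hW.1.1⟩, le_of_forall_gt_imp_ge_of_dense fun c hc => ?_⟩
  obtain ⟨W', hW', hp'⟩ := hex (min c (g + 1)) (lt_min hc (by linarith))
  exact (hmin (hmem W' hW' (hp'.le.trans (min_le_right _ _)))).trans
    (hp'.le.trans (min_le_left _ _))

/-! ### The minimax argument -/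

lemma innerFeasible_iff (D : Downlink N K)
    {V : Fin K → Matrix (Fin N ⊕ Unit) (Fin N ⊕ Unit) ℂ}
    (hV : ∀ i, V i (Sum.inr ()) (Sum.inr ()) = 1) (W : Fin K → Matrix (Fin N) (Fin N) ℂ) :
    InnerFeasible D V W ↔
      (∀ i, 0 ≤ (Psi D W 0 i * V i).trace.re) ∧ ∀ i, (W i).PosSemidef := by
  refine and_congr (forall_congr' fun i => ?_) Iff.rfl
  rw [trace_Psi_zero_mul, hV i, Complex.one_re, mul_one, sub_nonneg]

/-- Weak duality: pairing the semidefinite constraint with an outer feasible `V i` gives the inner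
constraint, because the multiplier only enters through the slack of the trace bound. -/
lemma SDRFeasible.innerFeasible {D : Downlink N K} {W : Fin K → Matrix (Fin N) (Fin N) ℂ}
    {l : Fin K → ℝ} (hW : SDRFeasible D W l)
    {V : Fin K → Matrix (Fin N ⊕ Unit) (Fin N ⊕ Unit) ℂ} (hV : OuterFeasible D V) :
    InnerFeasible D V W := by
  refine (innerFeasible_iff D (fun i => (hV i).2.1) W).2 ⟨fun i => ?_, hW.2.1⟩
  have h1 := (hW.1 i).trace_mul_re_nonneg (hV i).2.2
  rw [Psi_eq_sub_smul_ballForm, Matrix.sub_mul, trace_sub, Matrix.smul_mul, trace_smul,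
    Complex.sub_re, Complex.smul_re, smul_eq_mul, trace_ballForm_mul, (hV i).2.1,
    Complex.one_re, mul_one] at h1
  have h2 := mul_nonneg (hW.2.2 i) (sub_nonneg.2 (hV i).1)
  linarith

/-- The convex cone generated by the outer feasible set, receiver by receiver: the trace bound is
homogenized by the corner entry. -/
def outerCone (D : Downlink N K) : Set (Fin K → Matrix (Fin N ⊕ Unit) (Fin N ⊕ Unit) ℂ) :=
  {U | ∀ i, (U i).PosSemidef ∧ 0 ≤ (ballForm D i * U i).trace.re}

lemma convex_outerCone (D : Downlink N K) : Convex ℝ (outerCone D) := by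
  intro U hU U' hU' a b ha hb _ i
  refine ⟨((hU i).1.smul ha).add ((hU' i).1.smul hb), ?_⟩
  have : (ballForm D i * (a • U + b • U') i).trace.re =
      a * (ballForm D i * U i).trace.re + b * (ballForm D i * U' i).trace.re := by
    simp [Matrix.mul_add]
  rw [this]
  exact add_nonneg (mul_nonneg ha (hU i).2) (mul_nonneg hb (hU' i).2)

/-- Normalizing the corner entries turns a point of the cone into an outer feasible point. -/
lemma exists_outerFeasible_of_mem_outerCone {D : Downlink N K}
    {U : Fin K → Matrix (Fin N ⊕ Unit) (Fin N ⊕ Unit) ℂ} (hU : U ∈ outerCone D) :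
    ∃ V, OuterFeasible D V ∧ ∀ i, ∃ u : ℝ, 0 ≤ u ∧ U i = u • V i := by
  have key : ∀ i, ∃ V : Matrix (Fin N ⊕ Unit) (Fin N ⊕ Unit) ℂ,
      (V.trace.re ≤ 1 + D.r i ^ 2 ∧ V (Sum.inr ()) (Sum.inr ()) = 1 ∧ V.PosSemidef) ∧
        ∃ u : ℝ, 0 ≤ u ∧ U i = u • V := by
    intro i
    obtain ⟨hpsd, htr⟩ := hU i
    rw [trace_ballForm_mul] at htr
    obtain ⟨hu, hui⟩ := Complex.nonneg_iff.1 (hpsd.diag_nonneg (i := Sum.inr ()))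
    have hreal : U i (Sum.inr ()) (Sum.inr ()) =
        ((U i (Sum.inr ()) (Sum.inr ())).re : ℂ) := Complex.ext rfl hui.symm
    set u := (U i (Sum.inr ()) (Sum.inr ())).re with hudef
    rcases hu.eq_or_lt with hu0 | hu0
    · -- a vanishing corner forces `U i = 0`, and any feasible matrix will do
      have h0 : U i = 0 := by
        rw [← hpsd.trace_eq_zero_iff]
        have h1 := Complex.nonneg_iff.1 hpsd.trace_nonneg
        refine Complex.ext (le_antisymm ?_ h1.1) h1.2.symm
        rw [← hu0] at htr
        simpa using htr
      let x : Fin N ⊕ Unit → ℂ := Sum.elim 0 1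
      refine ⟨vecMulVec x (star x), ⟨?_, ?_, posSemidef_vecMulVec_self_star x⟩, 0, le_rfl, ?_⟩
      · simp [x, trace, vecMulVec, Fintype.sum_sum_type]
        positivity
      · simp [x, vecMulVec]
      · rw [h0, zero_smul]
    · refine ⟨u⁻¹ • U i, ⟨?_, ?_, hpsd.smul (inv_nonneg.2 hu)⟩, u, hu, ?_⟩
      · rw [trace_smul, Complex.smul_re, smul_eq_mul, inv_mul_le_iff₀ hu0]
        linarith
      · rw [Matrix.smul_apply, hreal, Complex.real_smul, ← Complex.ofReal_mul,
          inv_mul_cancel₀ hu0.ne', Complex.ofReal_one]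
      · rw [smul_inv_smul₀ hu0.ne']
  choose V hV hu using key
  exact ⟨V, hV, hu⟩

/-- The weighted violation `-∑ i, tr (Ψ i (W, 0) U i)` of the constraints, the payoff of the minimax
argument. -/
noncomputable def violation (D : Downlink N K) (W : Fin K → Matrix (Fin N) (Fin N) ℂ)
    (U : Fin K → Matrix (Fin N ⊕ Unit) (Fin N ⊕ Unit) ℂ) : ℝ :=
  -∑ i, (Psi D W 0 i * U i).trace.re

lemma continuous_violation_left (D : Downlink N K)
    (U : Fin K → Matrix (Fin N ⊕ Unit) (Fin N ⊕ Unit) ℂ) :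
    Continuous fun W => violation D W U := by
  simp only [violation, trace_Psi_zero_mul]
  refine (continuous_finsetSum _ fun i _ => Continuous.sub ?_ continuous_const).neg
  exact (continuous_apply i).comp (continuous_receivedPower D U)

lemma violation_combo_left (D : Downlink N K)
    (U : Fin K → Matrix (Fin N ⊕ Unit) (Fin N ⊕ Unit) ℂ)
    (W W' : Fin K → Matrix (Fin N) (Fin N) ℂ) {a b : ℝ} (hab : a + b = 1) :
    violation D (a • W + b • W') U = a * violation D W U + b * violation D W' U := by
  have h : ∀ W i, (signalMinusInterference D W i * corr D U i).trace.re = receivedPower D U W i :=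
    fun _ _ => rfl
  obtain rfl : b = 1 - a := by linarith
  simp only [violation, trace_Psi_zero_mul, h, map_add, map_smul, Pi.add_apply, Pi.smul_apply,
    smul_eq_mul, mul_neg, Finset.mul_sum, ← Finset.sum_neg_distrib, ← Finset.sum_add_distrib]
  exact Finset.sum_congr rfl fun i _ => by ring

lemma continuous_violation_right (D : Downlink N K) (W : Fin K → Matrix (Fin N) (Fin N) ℂ) :
    Continuous fun U => violation D W U := by
  unfold violation
  fun_prop

lemma violation_combo_right (D : Downlink N K) (W : Fin K → Matrix (Fin N) (Fin N) ℂ)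
    (U U' : Fin K → Matrix (Fin N ⊕ Unit) (Fin N ⊕ Unit) ℂ) (a b : ℝ) :
    violation D W (a • U + b • U') = a * violation D W U + b * violation D W U' := by
  simp [violation, Matrix.mul_add, Finset.sum_add_distrib, Finset.mul_sum]
  ring

/-- Strong duality: if every inner value is at most `g`, then the semidefinite relaxation has a
feasible point of power at most `g`. For each `U` in the outer cone some tuple of power at most `g`
has nonpositive violation; Sion's lemma and compactness make one tuple work for all `U`, and testing
it against rank-one `U` gives the hypothesis of the S-procedure. -/
lemma exists_sdrFeasible_of_forall_innerValue_le {D : Downlink N K} (hr : ∀ i, 0 < D.r i) {g : ℝ}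
    (hg : ∀ V, OuterFeasible D V → innerValue D V ≤ (g : EReal)) :
    ∃ W l, SDRFeasible D W l ∧ power W ≤ g := by
  have hpt : ∀ U ∈ outerCone D, ∃ W ∈ boundedPower N K g, violation D W U ≤ 0 := by
    intro U hU
    obtain ⟨V, hV, hUV⟩ := exists_outerFeasible_of_mem_outerCone hU
    obtain ⟨W, hW, hp⟩ := exists_innerFeasible_of_innerValue_le (hg V hV)
    refine ⟨W, ⟨hW.2, hp⟩, neg_nonpos.2 (Finset.sum_nonneg fun i _ => ?_)⟩
    obtain ⟨u, hu, hUi⟩ := hUV i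
    rw [hUi, Matrix.mul_smul, trace_smul, Complex.smul_re, smul_eq_mul]
    exact mul_nonneg hu (((innerFeasible_iff D (fun i => (hV i).2.1) W).1 hW).1 i)
  have hne : (boundedPower N K g).Nonempty := by
    obtain ⟨W, hW, -⟩ := hpt 0 fun i => by simp [PosSemidef.zero]
    exact ⟨W, hW⟩
  obtain ⟨W, hW, hWU⟩ := (isCompact_boundedPower g).inter_iInter_nonempty
    (fun U : outerCone D => {W | violation D W U ≤ 0})
    (fun U => isClosed_le (continuous_violation_left D U) continuous_const) (by
      intro s
      by_contra hempty
      have hall : ∀ W ∈ boundedPower N K g,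
          ∃ U ∈ (Subtype.val '' (s : Set (outerCone D))), 0 < violation D W U := by
        intro W hW
        by_contra! hle
        exact hempty ⟨W, hW, Set.mem_iInter₂.2 fun U hU => hle U ⟨U, hU, rfl⟩⟩
      obtain ⟨U, hU, hlt⟩ := Sion.exists_lt_iInf_of_lt_iInf_of_finite
        (X := boundedPower N K g) (Y := outerCone D) (f := violation D) hne
        (isCompact_boundedPower g)
        (fun U _ => (continuous_violation_left D U).lowerSemicontinuous.lowerSemicontinuousOn _)
        (fun U _ => ConvexOn.quasiconvexOn ⟨convex_boundedPower g, fun W _ W' _ a b _ _ hab =>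
          (violation_combo_left D U W W' hab).le⟩)
        (convex_outerCone D)
        (fun W _ => (continuous_violation_right D W).upperSemicontinuous.upperSemicontinuousOn _)
        (fun W _ => ConcaveOn.quasiconcaveOn ⟨convex_outerCone D, fun U _ U' _ a b _ _ _ =>
          (violation_combo_right D W U U' a b).ge⟩)
        (convex_boundedPower g) (s.finite_toSet.image _)
        (by rintro _ ⟨U, -, rfl⟩; exact U.2) hall
      obtain ⟨W, hW, hle⟩ := hpt U hU
      exact absurd (hlt W hW) hle.not_gt)
  have hPsi : ∀ i, ∃ l : ℝ, 0 ≤ l ∧ (Psi D W l i).PosSemidef := by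
    intro i
    rw [exists_Psi_posSemidef_iff D (fun k => (hW.1 k).1) i (hr i)]
    intro x hx
    have hmem : (Pi.single i (vecMulVec x (star x)) :
        Fin K → Matrix (Fin N ⊕ Unit) (Fin N ⊕ Unit) ℂ) ∈ outerCone D := by
      intro k
      by_cases hk : k = i
      · subst hk
        rw [Pi.single_eq_same, ← quadForm_eq_trace]
        exact ⟨posSemidef_vecMulVec_self_star x, hx⟩
      · rw [Pi.single_eq_of_ne hk]
        simp [PosSemidef.zero]
    have h1 : violation D W (Pi.single i (vecMulVec x (star x))) ≤ 0 :=
      Set.mem_iInter.1 hWU ⟨_, hmem⟩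
    rw [violation, Finset.sum_eq_single i (fun k _ hk => by rw [Pi.single_eq_of_ne hk]; simp)
      (by simp), Pi.single_eq_same, ← quadForm_eq_trace] at h1
    linarith
  choose l hl hP using hPsi
  exact ⟨W, l, ⟨hP, hW.1, hl⟩, hW.2⟩

end RobustBeamforming

open RobustBeamforming in
theorem claim1 {N K : ℕ} (D : Downlink N K)
    (hσ : ∀ i, 0 < D.σ i ^ 2) (hr : ∀ i, 0 < D.r i) (hγ : ∀ i, 0 < D.γ i)
    (hcond : UniqueInnerSolution D) :
    (∃ W l, SDROptimal D W l ∧ ∀ i, (W i).rank = 1) ∧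
    ∀ W l, SDROptimal D W l →
      (∀ i, (W i).rank = 1) ∧
      (∃ w : Fin K → EuclideanSpace ℂ (Fin N), ∀ i, W i = outer (w i)) ∧
      ∀ w : Fin K → EuclideanSpace ℂ (Fin N), (∀ i, W i = outer (w i)) →
        RobustOptimal D w := by
  obtain ⟨V, hV, W₀, hW₀, huniq⟩ := hcond
  have hval : innerValue D V ≤ (power W₀ : EReal) := iInf₂_le W₀ hW₀.1
  obtain ⟨W₁, l₁, hfeas, hpow⟩ := exists_sdrFeasible_of_forall_innerValue_le hr
    (g := power W₀) fun V' hV' => (hV.2 V' hV').trans hval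
  have hlower : ∀ W l, SDRFeasible D W l → power W₀ ≤ power W := fun W l h =>
    hW₀.2 W (h.innerFeasible hV.1)
  have heq : ∀ W l, SDRFeasible D W l → power W ≤ power W₀ → W = W₀ := fun W l h hp =>
    huniq W ⟨h.innerFeasible hV.1, fun W' hW' => hp.trans (hW₀.2 W' hW')⟩
  have hrank : ∀ i, ∃ w : EuclideanSpace ℂ (Fin N), w ≠ 0 ∧ W₀ i = outer w :=
    exists_eq_outer_of_unique hσ (fun i => (hV.1 i).2.2) hW₀ huniq
  have hrank1 : ∀ i, (W₀ i).rank = 1 := fun i => by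
    obtain ⟨w, hw, h⟩ := hrank i
    rw [h, rank_outer hw]
  refine ⟨⟨W₁, l₁, ⟨hfeas, fun W' l' h' => hpow.trans (hlower W' l' h')⟩, ?_⟩, ?_⟩
  · rw [heq W₁ l₁ hfeas hpow]
    exact hrank1
  · intro W l hopt
    obtain rfl : W = W₀ := heq W l hopt.1 ((hopt.2 W₁ l₁ hfeas).trans hpow)
    refine ⟨hrank1, ?_, fun w hw => ?_⟩
    · choose w _ hw using hrank
      exact ⟨w, hw⟩
    · obtain rfl : W = fun k => outer (w k) := funext hw
      refine ⟨(robustFeasible_iff D hσ hr hγ w).2 ⟨l, hopt.1⟩, fun w' hw' => ?_⟩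
      obtain ⟨l', hl'⟩ := (robustFeasible_iff D hσ hr hγ w').1 hw'
      rw [← power_outer, ← power_outer]
      exact hopt.2 _ _ hl'
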